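/- Fix $g\ge 0$ and a disk with $g$ marked points on its boundary circle. A \emph{tangle diagram} is a link-diagram-like picture in the disk: finitely many arcs and closed curves, in general position, whose arcs end exactly at the $g$ marked points, with over/under information at each (transverse double point) crossing. A \emph{framed tangle} is a tangle diagram up to planar isotopy of the interior of the disk and framed Reidemeister moves. A \emph{base tangle} is the planar isotopy class of a tangle diagram with no crossings and no closed components. Let $\mathcal M_g$ be the Kauffman skein module, that is, the free $\mathbb Z[A,A^{-1}]$-module on framed tangles modulo the submodule generated by the relations, among diagrams that agree outside a small disk, (i) $D\sqcup\bigcirc=(-A^2-A^{-2})\,D$, where $\bigcirc$ is a circle bounding an empty disk, and (ii) $D=A\,D_A+A^{-1}D_B$, where $D_A$ and $D_B$ are the two smoothings of $D$ at a crossing ($D_A$ joins the two regions swept out by turning the over strand counterclockwise). The \emph{span} of a nonzero Laurent polynomial in $A$ is its highest exponent minus its lowest exponent, and the span of $0$ is $0$. \textbf{Corollary.} Every framed tangle $T$ can be written in $\mathcal M_g$ in exactly one way as a finite linear combination $T=\sum_B P^T_B(A)\,B$ of base tangles, with $P^T_B\in\mathbb Z[A,A^{-1}]$, and for every base tangle $B$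 the span of $P^T_B$ is a non-negative multiple of $4$. -/

import Mathlib

open scoped LaurentPolynomial

namespace Skein

/-! ## Tangle diagrams

A tangle diagram is drawn in a rectangle (a disk) with its `g` boundary points on the top side, in
general position with respect to the height.  Reading upwards it is a finite sequence of horizontal
slices.  Each slice is a row of vertical strands, numbered `0, 1, 2, …` from the left, into which
one elementary piece (a minimum, a maximum or a crossing) is inserted. -/

/-- The elementary pieces.  `crossing true` is the crossing whose over strand runs from bottom left
to top right, `crossing false` the one whose over strand runs from bottom right to top left. -/
inductive Piece
  | cup
  | cap
  | crossing (overUpRight : Bool)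
  deriving DecidableEq

/-- The number of strands that enter the piece from below. -/
def Piece.inp : Piece → ℕ
  | .cup => 0
  | .cap => 2
  | .crossing _ => 2

/-- The number of strands that leave the piece at its top. -/
def Piece.out : Piece → ℕ
  | .cup => 2
  | .cap => 0
  | .crossing _ => 2

/-- A slice: a piece together with the number of vertical strands to the left of it. -/
structure Slice where
  piece : Piece
  pos : ℕ

def cup (i : ℕ) : Slice := ⟨.cup, i⟩

def cap (i : ℕ) : Slice := ⟨.cap, i⟩

def cross (c : Bool) (i : ℕ) : Slice := ⟨.crossing c, i⟩

/-- `Fits n w m`: the slices of `w`, stacked upwards, can be put on top of `n` strands, and then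
`m` strands leave at the top. -/
def Fits : ℕ → List Slice → ℕ → Prop
  | n, [], m => n = m
  | n, s :: w, m => s.pos + s.piece.inp ≤ n ∧ Fits (n - s.piece.inp + s.piece.out) w m

/-- A tangle diagram with `g` boundary points, in general position with respect to the height. -/
structure Diagram (g : ℕ) where
  word : List Slice
  fits : Fits 0 word g

/-! ## Planar isotopy and framed Reidemeister moves -/

/-- The elementary planar isotopies between diagrams in general position: two pieces standing side
by side exchange their heights; a maximum and a minimum of a strand cancel; a maximum or a minimum
of one strand is moved through a crossing with another strand. -/
inductive PlanarMove : List Slice → List Slice → Prop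
  | exchange (a b : Piece) (i k : ℕ) :
      PlanarMove [⟨a, i⟩, ⟨b, i + a.out + k⟩] [⟨b, i + a.inp + k⟩, ⟨a, i⟩]
  | zigzag (i : ℕ) : PlanarMove [cup i, cap (i + 1)] []
  | zigzag' (i : ℕ) : PlanarMove [cup (i + 1), cap i] []
  | swingCap (c : Bool) (i : ℕ) :
      PlanarMove [cross c i, cap (i + 1)] [cross (!c) (i + 1), cap i]
  | swingCup (c : Bool) (i : ℕ) :
      PlanarMove [cup (i + 1), cross c i] [cup i, cross (!c) (i + 1)]

/-- The framed Reidemeister moves: in `R1` a curl on one side of a strand is replaced by the curl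
on the other side that has the same framing. -/
inductive ReidemeisterMove : List Slice → List Slice → Prop
  | R1 (c : Bool) (i : ℕ) :
      ReidemeisterMove [cup (i + 1), cross c i, cap (i + 1)] [cup i, cross c (i + 1), cap i]
  | R2 (c : Bool) (i : ℕ) : ReidemeisterMove [cross c i, cross (!c) i] []
  | R3 (c : Bool) (i : ℕ) :
      ReidemeisterMove [cross c i, cross c (i + 1), cross c i]
        [cross c (i + 1), cross c i, cross c (i + 1)]

/-- Two diagrams that agree except that one contains, in some place, the left hand side of a local
move and the other its right hand side. -/
def LocalStep (move : List Slice → List Slice → Prop) {g : ℕ} (D D' : Diagram g) : Prop :=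
  ∃ u a b v : List Slice, move a b ∧ D.word = u ++ a ++ v ∧ D'.word = u ++ b ++ v

/-- Planar isotopy classes of tangle diagrams with `g` boundary points. -/
def PlanarClass (g : ℕ) : Type :=
  Quot (LocalStep PlanarMove (g := g))

/-- Framed tangles with `g` boundary points: tangle diagrams up to planar isotopy and framed
Reidemeister moves. -/
def FramedTangle (g : ℕ) : Type :=
  Quot (fun D D' : Diagram g => LocalStep PlanarMove D D' ∨ LocalStep ReidemeisterMove D D')

/-- The planar isotopy class of a diagram. -/
def Diagram.planarClass {g : ℕ} (D : Diagram g) : PlanarClass g := Quot.mk _ D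

/-- The framed tangle represented by a diagram. -/
def Diagram.tangle {g : ℕ} (D : Diagram g) : FramedTangle g := Quot.mk _ D

/-- The framed tangle represented by a planar isotopy class of diagrams. -/
def PlanarClass.tangle {g : ℕ} : PlanarClass g → FramedTangle g :=
  Quot.lift Diagram.tangle fun _ _ h => Quot.sound (Or.inl h)

/-! ## Base tangles -/

/-- The point `(t, p)` is the strand number `p` at height `t`, where height `t` lies below the
slice number `t`.  `Adjacent w x y` holds for two points joined by a strand segment inside a single
slice of `w`. -/
inductive Adjacent (w : List Slice) : ℕ × ℕ → ℕ × ℕ → Prop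
  | left (t : ℕ) (s : Slice) (p : ℕ) (hs : w[t]? = some s) (hp : p < s.pos) :
      Adjacent w (t, p) (t + 1, p)
  | right (t : ℕ) (s : Slice) (p : ℕ) (hs : w[t]? = some s) (hp : s.pos ≤ p) :
      Adjacent w (t, p + s.piece.inp) (t + 1, p + s.piece.out)
  | cup (t i : ℕ) (hs : w[t]? = some (cup i)) : Adjacent w (t + 1, i) (t + 1, i + 1)
  | cap (t i : ℕ) (hs : w[t]? = some (cap i)) : Adjacent w (t, i) (t, i + 1)
  | upRight (t i : ℕ) (c : Bool) (hs : w[t]? = some (cross c i)) :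
      Adjacent w (t, i) (t + 1, i + 1)
  | upLeft (t i : ℕ) (c : Bool) (hs : w[t]? = some (cross c i)) :
      Adjacent w (t, i + 1) (t + 1, i)

/-- No piece of the diagram is a crossing. -/
def Diagram.Crossingless {g : ℕ} (D : Diagram g) : Prop :=
  ∀ s ∈ D.word, ∀ c : Bool, s.piece ≠ .crossing c

/-- The diagram has no closed component: every point of it is joined along its strand to one of
the `g` boundary points. -/
def Diagram.Loopless {g : ℕ} (D : Diagram g) : Prop :=
  ∀ t n p : ℕ, t ≤ D.word.length → Fits 0 (D.word.take t) n → p < n →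
    ∃ q < g, Relation.EqvGen (Adjacent D.word) (t, p) (D.word.length, q)

/-- Base tangles: planar isotopy classes of crossingless, loopless tangle diagrams. -/
def BaseTangle (g : ℕ) : Type :=
  {B : PlanarClass g // ∃ D : Diagram g, D.Crossingless ∧ D.Loopless ∧ D.planarClass = B}

/-! ## The Kauffman skein module -/

/-- The free module over `ℤ[A, A⁻¹]` on the framed tangles with `g` boundary points. -/
abbrev TangleModule (g : ℕ) : Type := FramedTangle g →₀ ℤ[T;T⁻¹]

/-- A diagram as an element of the free module. -/
noncomputable def Diagram.gen {g : ℕ} (D : Diagram g) : TangleModule g :=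
  Finsupp.single D.tangle 1

/-- The Kauffman relations among diagrams that agree outside a small disk.  The monomial `A ^ k` is
`LaurentPolynomial.T k`.
* `loop`: a diagram with an additional small circle is `-A² - A⁻²` times the diagram without it.
* `crossing`, `crossing'`: a crossing is `A` times the smoothing that joins the two regions swept
  out when the over strand is turned counterclockwise, plus `A⁻¹` times the other smoothing. -/
inductive KauffmanRelator (g : ℕ) : TangleModule g → Prop
  | loop (D D₀ : Diagram g) (u v : List Slice) (i : ℕ)
      (h : D.word = u ++ [cup i, cap i] ++ v) (h₀ : D₀.word = u ++ v) :
      KauffmanRelator g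
        (D.gen - (-LaurentPolynomial.T 2 - LaurentPolynomial.T (-2) : ℤ[T;T⁻¹]) • D₀.gen)
  | crossing (D D₁ D₂ : Diagram g) (u v : List Slice) (i : ℕ)
      (h : D.word = u ++ [cross true i] ++ v) (h₁ : D₁.word = u ++ v)
      (h₂ : D₂.word = u ++ [cap i, cup i] ++ v) :
      KauffmanRelator g
        (D.gen - ((LaurentPolynomial.T 1 : ℤ[T;T⁻¹]) • D₁.gen
          + (LaurentPolynomial.T (-1) : ℤ[T;T⁻¹]) • D₂.gen))
  | crossing' (D D₁ D₂ : Diagram g) (u v : List Slice) (i : ℕ)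
      (h : D.word = u ++ [cross false i] ++ v) (h₁ : D₁.word = u ++ [cap i, cup i] ++ v)
      (h₂ : D₂.word = u ++ v) :
      KauffmanRelator g
        (D.gen - ((LaurentPolynomial.T 1 : ℤ[T;T⁻¹]) • D₁.gen
          + (LaurentPolynomial.T (-1) : ℤ[T;T⁻¹]) • D₂.gen))

/-- The submodule generated by the Kauffman relations. -/
noncomputable def kauffmanSubmodule (g : ℕ) : Submodule ℤ[T;T⁻¹] (TangleModule g) :=
  Submodule.span ℤ[T;T⁻¹] {x | KauffmanRelator g x}

/-- The Kauffman skein module of the disk with `g` boundary points. -/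
abbrev SkeinModule (g : ℕ) : Type := TangleModule g ⧸ kauffmanSubmodule g

/-- The class of a framed tangle in the skein module. -/
noncomputable def FramedTangle.toSkein {g : ℕ} (T : FramedTangle g) : SkeinModule g :=
  (kauffmanSubmodule g).mkQ (Finsupp.single T 1)

/-- The class of a base tangle in the skein module. -/
noncomputable def BaseTangle.toSkein {g : ℕ} (B : BaseTangle g) : SkeinModule g :=
  B.1.tangle.toSkein

/-- `P` is the family of coefficients of an expansion of the framed tangle `T` as a linear
combination of base tangles in the skein module. -/
def IsExpansion {g : ℕ} (T : FramedTangle g) (P : BaseTangle g →₀ ℤ[T;T⁻¹]) : Prop :=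
  T.toSkein = P.sum fun B p => p • B.toSkein

/-- The span of a Laurent polynomial: its highest exponent minus its lowest exponent, and `0` for
the zero polynomial. -/
noncomputable def laurentSpan (p : ℤ[T;T⁻¹]) : ℤ := by
  classical
  exact if h : p.coeff.support.Nonempty then p.coeff.support.max' h - p.coeff.support.min' h else 0

end Skein

/-! Existence is a state expansion: smoothing all crossings leaves crossingless diagrams, and each
of these reduces, by planar isotopies and removal of circles, to a normal form, a stack of minima
whose positions increase upwards (`exists_reduces_cups`).

Uniqueness comes from a representation. A word acts on functions of Boolean labellings of the
strands; minima and maxima pair opposite labels, zigzags cancel, and a circle is worth `a + a⁻¹`.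
For `a = -A²` this gives a linear map `skeinBracket` on the skein module. In a normal form the
positions are the left ends of the arcs, and the boundary labelling marking these ends is
lexicographically largest in the support of the image, with a unit as coefficient. So base tangles
have triangular images and are independent (`linearIndependent_toSkein`).

At `a = 1` the same representation counts labellings: each removed circle contributes a factor 2,
while a loopless diagram has at most one labelling extending given top labels. Hence reducing a
loopless diagram removes no circle, and every base tangle is a normal form (`exists_eq_cupsBase`).

For the span, diagrams carry a degree in `ZMod 4`, invariant under planar isotopy and compatible
with the Kauffman relations when `A` has degree 1. All exponents of one coefficient are therefore
congruent modulo 4 (`exists_homogeneous_expansion`). -/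

namespace Skein

/-! ## The spin representation -/

/-- The labelling `x` with the labels at `i` and `i + 1` removed. -/
def removePair (i : ℕ) (x : ℕ → Bool) : ℕ → Bool := fun p => if p < i then x p else x (p + 2)

/-- The labelling `x` with the labels `b` and `!b` inserted at `i` and `i + 1`. -/
def insertPair (i : ℕ) (b : Bool) (x : ℕ → Bool) : ℕ → Bool := fun p =>
  if p < i then x p else if p = i then b else if p = i + 1 then !b else x (p - 2)

section Spin

variable {R : Type*} [CommRing R]

/-- The weight of a minimum whose left end has the label `b`. -/
def cupWeight (a : Rˣ) (b : Bool) : R := if b then a else 1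

/-- The weight of a maximum whose left end has the label `b`. -/
def capWeight (a : Rˣ) (b : Bool) : R := if b then 1 else (a⁻¹ : Rˣ)

/-- The action of a minimum on functions of labellings. -/
def cupOp (a : Rˣ) (i : ℕ) : Module.End R ((ℕ → Bool) → R) where
  toFun v := fun x => (if x (i + 1) = !x i then cupWeight a (x i) else 0) * v (removePair i x)
  map_add' v w := by ext x; simp [mul_add]
  map_smul' r v := by ext x; simp [mul_left_comm]

/-- The action of a maximum on functions of labellings. -/
def capOp (a : Rˣ) (i : ℕ) : Module.End R ((ℕ → Bool) → R) where
  toFun v := fun x => capWeight a true * v (insertPair i true x)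
    + capWeight a false * v (insertPair i false x)
  map_add' v w := by ext x; simp; ring
  map_smul' r v := by ext x; simp; ring

theorem cupOp_apply (a : Rˣ) (i : ℕ) (v : (ℕ → Bool) → R) (x : ℕ → Bool) :
    cupOp a i v x = (if x (i + 1) = !x i then cupWeight a (x i) else 0) * v (removePair i x) :=
  rfl

theorem capOp_apply (a : Rˣ) (i : ℕ) (v : (ℕ → Bool) → R) (x : ℕ → Bool) :
    capOp a i v x = capWeight a true * v (insertPair i true x)
      + capWeight a false * v (insertPair i false x) :=
  rfl

theorem removePair_insertPair (i : ℕ) (b : Bool) (x : ℕ → Bool) :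
    removePair i (insertPair i b x) = x := by
  ext p; grind [removePair, insertPair]

theorem removePair_insertPair_succ (i : ℕ) (x : ℕ → Bool) :
    removePair i (insertPair (i + 1) (!x i) x) = x := by
  ext p; grind [removePair, insertPair]

theorem removePair_succ_insertPair (i : ℕ) (x : ℕ → Bool) :
    removePair (i + 1) (insertPair i (x i) x) = x := by
  ext p; grind [removePair, insertPair]

theorem removePair_removePair (i k : ℕ) (x : ℕ → Bool) :
    removePair i (removePair (i + 2 + k) x) = removePair (i + k) (removePair i x) := by
  ext p; grind [removePair]

theorem insertPair_insertPair (i k : ℕ) (b c : Bool) (x : ℕ → Bool) :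
    insertPair i b (insertPair (i + k) c x) = insertPair (i + 2 + k) c (insertPair i b x) := by
  ext p; grind (splits := 20) [insertPair]

theorem removePair_insertPair_add (i k : ℕ) (b : Bool) (x : ℕ → Bool) :
    removePair i (insertPair (i + 2 + k) b x) = insertPair (i + k) b (removePair i x) := by
  ext p; grind [removePair, insertPair]

theorem insertPair_removePair_add (i k : ℕ) (b : Bool) (x : ℕ → Bool) :
    insertPair i b (removePair (i + k) x) = removePair (i + 2 + k) (insertPair i b x) := by
  ext p; grind [removePair, insertPair]

theorem insertPair_left (i : ℕ) (b : Bool) (x : ℕ → Bool) : insertPair i b x i = b := by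
  simp [insertPair]

theorem insertPair_right (i : ℕ) (b : Bool) (x : ℕ → Bool) : insertPair i b x (i + 1) = !b := by
  simp [insertPair]

theorem insertPair_of_lt {i p : ℕ} (b : Bool) (x : ℕ → Bool) (h : p < i) :
    insertPair i b x p = x p := by
  simp [insertPair, h]

theorem insertPair_of_le {i p : ℕ} (b : Bool) (x : ℕ → Bool) (h : i ≤ p) :
    insertPair i b x (p + 2) = x p := by
  grind [insertPair]

theorem removePair_of_lt {i p : ℕ} (x : ℕ → Bool) (h : p < i) : removePair i x p = x p := by
  simp [removePair, h]

theorem removePair_of_le {i p : ℕ} (x : ℕ → Bool) (h : i ≤ p) :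
    removePair i x p = x (p + 2) := by
  grind [removePair]

/-! ### Temperley–Lieb relations -/

theorem capOp_mul_cupOp (a : Rˣ) (i : ℕ) :
    capOp a i * cupOp a i = ((a : R) + (a⁻¹ : Rˣ)) • (1 : Module.End R ((ℕ → Bool) → R)) := by
  ext v x
  simp [capOp_apply, cupOp_apply, insertPair_left, insertPair_right, removePair_insertPair,
    cupWeight, capWeight]
  ring

/-- Along a zigzag the minimum and the maximum have opposite left labels, and `cupWeight a b *
capWeight a (!b) = 1`; the weights are asymmetric to achieve this without signs or square roots. -/
theorem capOp_succ_mul_cupOp (a : Rˣ) (i : ℕ) : capOp a (i + 1) * cupOp a i = 1 := by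
  ext v x
  have h := removePair_insertPair_succ i x
  simp only [Module.End.mul_apply, capOp_apply, cupOp_apply, insertPair_left,
    insertPair_of_lt _ _ (Nat.lt_succ_self i), Module.End.one_apply]
  cases hx : x i <;> simp_all [cupWeight, capWeight]

theorem capOp_mul_cupOp_succ (a : Rˣ) (i : ℕ) : capOp a i * cupOp a (i + 1) = 1 := by
  ext v x
  have h := removePair_succ_insertPair i x
  simp only [Module.End.mul_apply, capOp_apply, cupOp_apply, insertPair_right,
    insertPair_of_le _ _ (le_refl i), Module.End.one_apply]
  cases hx : x i <;> simp_all [cupWeight, capWeight]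

theorem cupOp_mul_cupOp (a : Rˣ) (i k : ℕ) :
    cupOp a (i + 2 + k) * cupOp a i = cupOp a i * cupOp a (i + k) := by
  ext v x
  simp only [Module.End.mul_apply, cupOp_apply, removePair_removePair,
    removePair_of_lt x (show i < i + 2 + k by lia),
    removePair_of_lt x (show i + 1 < i + 2 + k by lia),
    removePair_of_le x (show i ≤ i + k by lia), removePair_of_le x (show i ≤ i + k + 1 by lia),
    show i + k + 1 + 2 = i + 2 + k + 1 by ring, show i + k + 2 = i + 2 + k by ring]
  ring

theorem capOp_mul_capOp (a : Rˣ) (i k : ℕ) :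
    capOp a (i + k) * capOp a i = capOp a i * capOp a (i + 2 + k) := by
  ext v x
  simp only [Module.End.mul_apply, capOp_apply, insertPair_insertPair]
  ring

theorem capOp_mul_cupOp_add (a : Rˣ) (i k : ℕ) :
    capOp a (i + 2 + k) * cupOp a i = cupOp a i * capOp a (i + k) := by
  ext v x
  simp only [Module.End.mul_apply, capOp_apply, cupOp_apply, removePair_insertPair_add,
    insertPair_of_lt _ x (show i < i + 2 + k by lia),
    insertPair_of_lt _ x (show i + 1 < i + 2 + k by lia)]
  ring

theorem cupOp_add_mul_capOp (a : Rˣ) (i k : ℕ) :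
    cupOp a (i + k) * capOp a i = capOp a i * cupOp a (i + 2 + k) := by
  ext v x
  simp only [Module.End.mul_apply, capOp_apply, cupOp_apply, insertPair_removePair_add,
    show i + 2 + k = i + k + 2 by ring, insertPair_of_le _ x (show i ≤ i + k by lia), insertPair_of_le _ x (show i ≤ i + k + 1 by lia)]
  ring

/-! ### Invariance of the representation under planar and Reidemeister moves -/

/-- The action of an elementary piece; a crossing acts by the sum of its smoothings. -/
def pieceOp (a t : Rˣ) : Piece → ℕ → Module.End R ((ℕ → Bool) → R)
  | .cup, i => cupOp a i
  | .cap, i => capOp a i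
  | .crossing true, i => (t : R) • 1 + ((t⁻¹ : Rˣ) : R) • (cupOp a i * capOp a i)
  | .crossing false, i => (t : R) • (cupOp a i * capOp a i) + ((t⁻¹ : Rˣ) : R) • 1

/-- The action of a word, read upwards. -/
def wordOp (a t : Rˣ) : List Slice → Module.End R ((ℕ → Bool) → R)
  | [] => 1
  | s :: w => wordOp a t w * pieceOp a t s.piece s.pos

theorem wordOp_append (a t : Rˣ) (u v : List Slice) :
    wordOp a t (u ++ v) = wordOp a t v * wordOp a t u := by
  induction u with
  | nil => simp [wordOp]
  | cons s u ih => simp [wordOp, ih, mul_assoc]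

/-- It suffices to move `c` past a minimum and past a maximum: a crossing is a combination of `1`
and their product. -/
theorem pieceOp_exchange (a t : Rˣ) (b c : Piece) (i k : ℕ) :
    pieceOp a t c (i + b.out + k) * pieceOp a t b i
      = pieceOp a t b i * pieceOp a t c (i + b.inp + k) := by
  have aux : ∀ c k, (∀ i, pieceOp a t c (i + 2 + k) * cupOp a i
        = cupOp a i * pieceOp a t c (i + k)) ∧
      ∀ i, pieceOp a t c (i + k) * capOp a i = capOp a i * pieceOp a t c (i + 2 + k) := by
    intro c k
    have h1 : ∀ i, cupOp a (i + 2 + k) * capOp a (i + 2 + k) * cupOp a i =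
        cupOp a i * (cupOp a (i + k) * capOp a (i + k)) := fun i => by
      rw [mul_assoc, capOp_mul_cupOp_add, ← mul_assoc, cupOp_mul_cupOp, mul_assoc]
    have h2 : ∀ i, cupOp a (i + k) * capOp a (i + k) * capOp a i =
        capOp a i * (cupOp a (i + 2 + k) * capOp a (i + 2 + k)) := fun i => by
      rw [mul_assoc, capOp_mul_capOp, ← mul_assoc, cupOp_add_mul_capOp, mul_assoc]
    rcases c with _ | _ | _ | _
    · exact ⟨fun i => cupOp_mul_cupOp a i k, fun i => cupOp_add_mul_capOp a i k⟩
    · exact ⟨fun i => capOp_mul_cupOp_add a i k, fun i => capOp_mul_capOp a i k⟩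
    all_goals
      constructor <;> intro i <;>
        simp only [pieceOp, add_mul, mul_add, smul_mul_assoc, mul_smul_comm, one_mul, mul_one,
          h1, h2]
  have h3 : pieceOp a t c (i + 2 + k) * (cupOp a i * capOp a i) =
      cupOp a i * capOp a i * pieceOp a t c (i + 2 + k) := by
    rw [← mul_assoc, (aux c k).1, mul_assoc, (aux c k).2, mul_assoc]
  rcases b with _ | _ | _ | _
  · exact (aux c k).1 i
  · exact (aux c k).2 i
  all_goals
    simp only [Piece.inp, Piece.out]
    generalize pieceOp a t c (i + 2 + k) = X at h3 ⊢
    simp only [pieceOp, add_mul, mul_add, smul_mul_assoc, mul_smul_comm, one_mul, mul_one, h3]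

/-- No relation between `a` and `t` is needed here, which leaves `a = t = 1` available for counting
labellings. -/
theorem wordOp_planarMove (a t : Rˣ) {u v : List Slice} (h : PlanarMove u v) :
    wordOp a t u = wordOp a t v := by
  cases h with
  | exchange b c i k => simpa [wordOp] using pieceOp_exchange a t b c i k
  | zigzag i => simpa [wordOp, cup, cap, pieceOp] using capOp_succ_mul_cupOp a i
  | zigzag' i => simpa [wordOp, cup, cap, pieceOp] using capOp_mul_cupOp_succ a i
  | swingCap c i =>
    have h1 : capOp a (i + 1) * (cupOp a i * capOp a i) = capOp a i := by
      rw [← mul_assoc, capOp_succ_mul_cupOp, one_mul]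
    have h2 : capOp a i * (cupOp a (i + 1) * capOp a (i + 1)) = capOp a (i + 1) := by
      rw [← mul_assoc, capOp_mul_cupOp_succ, one_mul]
    cases c <;> simp [wordOp, cap, cross, pieceOp, mul_add, h1, h2, add_comm]
  | swingCup c i =>
    have h1 : cupOp a i * capOp a i * cupOp a (i + 1) = cupOp a i := by
      rw [mul_assoc, capOp_mul_cupOp_succ, mul_one]
    have h2 : cupOp a (i + 1) * capOp a (i + 1) * cupOp a i = cupOp a (i + 1) := by
      rw [mul_assoc, capOp_succ_mul_cupOp, mul_one]
    cases c <;> simp [wordOp, cup, cross, pieceOp, add_mul, h1, h2, add_comm]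

theorem smoothing_mul_smoothing {E : Type*} [Ring E] [Algebra R E] {r s : R} (hrs : r * s = 1)
    {U : E} (hU : U * U = (-r ^ 2 - s ^ 2) • U) :
    (r • U + s • (1 : E)) * (r • 1 + s • U) = 1 := by
  have h : (r • U + s • (1 : E)) * (r • 1 + s • U)
      = (r ^ 2 + r * s * (-r ^ 2 - s ^ 2) + s ^ 2) • U + (r * s) • (1 : E) := by
    simp only [add_mul, mul_add, smul_mul_assoc, mul_smul_comm, one_mul, mul_one, hU]
    module
  rw [h, hrs]
  module

/-- The right hand side is symmetric in `U` and `V`, so two uses with the roles exchanged prove the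
third Reidemeister move. -/
theorem smoothing_braid {E : Type*} [Ring E] [Algebra R E] {r s : R} (hrs : r * s = 1)
    {U V : E} (hU : U * U = (-r ^ 2 - s ^ 2) • U) (hUVU : U * V * U = U) :
    (r • (1 : E) + s • U) * (r • (1 : E) + s • V) * (r • (1 : E) + s • U)
      = r ^ 3 • (1 : E) + r • (U + V) + s • (U * V + V * U) := by
  have h : (r • (1 : E) + s • U) * (r • (1 : E) + s • V) * (r • (1 : E) + s • U)
      = r ^ 3 • (1 : E) + (2 * r * (r * s) + (r * s) * s * (-r ^ 2 - s ^ 2) + s ^ 3) • U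
        + (r * (r * s)) • V + ((r * s) * s) • (U * V + V * U) := by
    simp only [add_mul, mul_add, smul_mul_assoc, mul_smul_comm, one_mul, mul_one, hU, hUVU]
    module
  have h1 : 2 * r * (r * s) + (r * s) * s * (-r ^ 2 - s ^ 2) + s ^ 3 = r := by
    linear_combination (2 * r - r ^ 2 * s - s ^ 3 - r) * hrs
  rw [h, h1, hrs]
  module

theorem wordOp_reidemeisterMove {a t : Rˣ} (hat : (a : R) = -t ^ 2) {u v : List Slice}
    (h : ReidemeisterMove u v) : wordOp a t u = wordOp a t v := by
  have hai : ((a⁻¹ : Rˣ) : R) = -((t⁻¹ : Rˣ) : R) ^ 2 := by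
    have h1 : a = -t ^ 2 := Units.ext (by simpa using hat)
    subst h1
    rw [show (-t ^ 2)⁻¹ = -(t⁻¹) ^ 2 by simp]
    simp
  have hti : (t : R) * ((t⁻¹ : Rˣ) : R) = 1 := by simp
  have hit : ((t⁻¹ : Rˣ) : R) * (t : R) = 1 := by simp
  have hloop : ∀ i, capOp a i * cupOp a i = (-t ^ 2 - ((t⁻¹ : Rˣ) : R) ^ 2) •
      (1 : Module.End R ((ℕ → Bool) → R)) := fun i => by
    rw [capOp_mul_cupOp, hat, hai, sub_eq_add_neg]
  have hUU : ∀ i, cupOp a i * capOp a i * (cupOp a i * capOp a i) =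
      (-t ^ 2 - ((t⁻¹ : Rˣ) : R) ^ 2) • (cupOp a i * capOp a i) := fun i => by
    rw [mul_assoc, ← mul_assoc (capOp a i), hloop]; simp
  -- For `crossing false` the roles of `t` and `t⁻¹` are exchanged; this is the form that the
  -- smoothing lemmas then require.
  have hUU' : ∀ i, cupOp a i * capOp a i * (cupOp a i * capOp a i) =
      (-((t⁻¹ : Rˣ) : R) ^ 2 - t ^ 2) • (cupOp a i * capOp a i) := fun i => by
    rw [hUU]; congr 1; ring
  cases h with
  | R1 c i =>
    have h1 : capOp a (i + 1) * (cupOp a i * capOp a i) * cupOp a (i + 1) = 1 := by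
      rw [← mul_assoc, capOp_succ_mul_cupOp, one_mul, capOp_mul_cupOp_succ]
    have h2 : capOp a i * (cupOp a (i + 1) * capOp a (i + 1)) * cupOp a i = 1 := by
      rw [← mul_assoc, capOp_mul_cupOp_succ, one_mul, capOp_succ_mul_cupOp]
    cases c <;>
      simp only [wordOp, cup, cap, cross, pieceOp, mul_add, add_mul, hloop, one_mul, mul_one,
        smul_mul_assoc, mul_smul_comm, h1, h2]
  | R2 c i =>
    cases c
    · have h := smoothing_mul_smoothing hit (hUU' i)
      simpa [wordOp, cross, pieceOp, add_comm] using h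
    · simpa [wordOp, cross, pieceOp] using smoothing_mul_smoothing hti (hUU i)
  | R3 c i =>
    have h1 : cupOp a i * capOp a i * (cupOp a (i + 1) * capOp a (i + 1)) *
        (cupOp a i * capOp a i) = cupOp a i * capOp a i := by
      rw [mul_assoc, mul_assoc, mul_assoc (cupOp a (i + 1)), ← mul_assoc (capOp a (i + 1)),
        capOp_succ_mul_cupOp, one_mul, ← mul_assoc (capOp a i), capOp_mul_cupOp_succ, one_mul]
    have h2 : cupOp a (i + 1) * capOp a (i + 1) * (cupOp a i * capOp a i) *
        (cupOp a (i + 1) * capOp a (i + 1)) = cupOp a (i + 1) * capOp a (i + 1) := by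
      rw [mul_assoc, mul_assoc, mul_assoc (cupOp a i), ← mul_assoc (capOp a i),
        capOp_mul_cupOp_succ, one_mul, ← mul_assoc (capOp a (i + 1)), capOp_succ_mul_cupOp,
        one_mul]
    cases c
    · have e1 := smoothing_braid hit (hUU' i) h1
      have e2 := smoothing_braid hit (hUU' (i + 1)) h2
      simp only [wordOp, cross, pieceOp, one_mul, add_comm ((t : R) • _)]
      rw [e1, e2]
      module
    · have e1 := smoothing_braid hti (hUU i) h1
      have e2 := smoothing_braid hti (hUU (i + 1)) h2
      simp only [wordOp, cross, pieceOp, one_mul]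
      rw [e1, e2]
      module

end Spin

/-! ## Reduction of crossingless words -/

theorem fits_append {n m : ℕ} {u v : List Slice} :
    Fits n (u ++ v) m ↔ ∃ k, Fits n u k ∧ Fits k v m := by
  induction u generalizing n with
  | nil => simp [Fits]
  | cons s u ih => simp [Fits, ih, and_assoc]

/-- `Reduces k u v`: the word `u` is turned into `v` by exchanges of heights, removals of zigzags
and removals of `k` small circles. -/
inductive Reduces : ℕ → List Slice → List Slice → Prop
  | refl (w : List Slice) : Reduces 0 w w
  | trans {k l : ℕ} {u v w : List Slice} : Reduces k u v → Reduces l v w → Reduces (k + l) u w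
  | append {k : ℕ} {a b : List Slice} (u v : List Slice) :
      Reduces k a b → Reduces k (u ++ a ++ v) (u ++ b ++ v)
  | exchange (a b : Piece) (i k : ℕ) :
      Reduces 0 [⟨a, i⟩, ⟨b, i + a.out + k⟩] [⟨b, i + a.inp + k⟩, ⟨a, i⟩]
  | exchange_symm (a b : Piece) (i k : ℕ) :
      Reduces 0 [⟨b, i + a.inp + k⟩, ⟨a, i⟩] [⟨a, i⟩, ⟨b, i + a.out + k⟩]
  | zigzag (i : ℕ) : Reduces 0 [cup i, cap (i + 1)] []
  | zigzag' (i : ℕ) : Reduces 0 [cup (i + 1), cap i] []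
  | loop (i : ℕ) : Reduces 1 [cup i, cap i] []

namespace Reduces

variable {k l : ℕ} {u v w : List Slice}

theorem append_left (u : List Slice) (h : Reduces k v w) : Reduces k (u ++ v) (u ++ w) := by
  simpa using h.append u []

theorem append_right (h : Reduces k u v) (w : List Slice) : Reduces k (u ++ w) (v ++ w) := by
  simpa using h.append [] w

theorem fits (h : Reduces k u v) {n m : ℕ} (hu : Fits n u m) : Fits n v m := by
  induction h generalizing n m with
  | refl w => exact hu
  | trans _ _ ih₁ ih₂ => exact ih₂ (ih₁ hu)
  | append u v _ ih =>
    simp only [fits_append] at hu ⊢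
    obtain ⟨p, ⟨q, h₁, h₂⟩, h₃⟩ := hu
    exact ⟨p, ⟨q, h₁, ih h₂⟩, h₃⟩
  | exchange a b i k => simp only [Fits] at hu ⊢; lia
  | exchange_symm a b i k => simp only [Fits] at hu ⊢; lia
  | zigzag i => simp only [Fits, cup, cap, Piece.inp, Piece.out] at hu ⊢; lia
  | zigzag' i => simp only [Fits, cup, cap, Piece.inp, Piece.out] at hu ⊢; lia
  | loop i => simp only [Fits, cup, cap, Piece.inp, Piece.out] at hu ⊢; lia

theorem wordOp_eq {R : Type*} [CommRing R] (a t : Rˣ) (h : Reduces k u v) :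
    wordOp a t u = ((a : R) + (a⁻¹ : Rˣ)) ^ k • wordOp a t v := by
  induction h with
  | refl w => simp
  | trans _ _ ih₁ ih₂ => rw [ih₁, ih₂, smul_smul, pow_add]
  | append u v _ ih => simp only [wordOp_append, ih, smul_mul_assoc, mul_smul_comm]
  | exchange b c i k => simpa using wordOp_planarMove a t (.exchange b c i k)
  | exchange_symm b c i k => simpa using (wordOp_planarMove a t (.exchange b c i k)).symm
  | zigzag i => simpa using wordOp_planarMove a t (.zigzag i)
  | zigzag' i => simpa using wordOp_planarMove a t (.zigzag' i)
  | loop i => simpa [wordOp, cup, cap, pieceOp] using capOp_mul_cupOp a i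

end Reduces

/-! ### Kauffman relations and reductions in the skein module -/

theorem LocalStep.planarClass_eq {g : ℕ} {D D' : Diagram g} (h : LocalStep PlanarMove D D') :
    D.planarClass = D'.planarClass := Quot.sound h

/-- The class of a diagram in the skein module. -/
noncomputable def Diagram.toSkein {g : ℕ} (D : Diagram g) : SkeinModule g := D.tangle.toSkein

theorem Diagram.toSkein_eq_of_planarClass_eq {g : ℕ} {D D' : Diagram g}
    (h : D.planarClass = D'.planarClass) : D.toSkein = D'.toSkein :=
  congrArg (fun B : PlanarClass g => B.tangle.toSkein) h

theorem Diagram.ext_word {g : ℕ} {D D' : Diagram g} (h : D.word = D'.word) : D = D' := by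
  cases D; cases D'; simpa using h

theorem KauffmanRelator.mkQ_eq_zero {g : ℕ} {x : TangleModule g} (h : KauffmanRelator g x) :
    (kauffmanSubmodule g).mkQ x = 0 := by
  rw [Submodule.mkQ_apply, Submodule.Quotient.mk_eq_zero]
  exact Submodule.subset_span h

/-- The value of a small circle. -/
noncomputable def loopValue : ℤ[T;T⁻¹] := -LaurentPolynomial.T 2 - LaurentPolynomial.T (-2)

theorem Diagram.toSkein_loop {g : ℕ} {D D₀ : Diagram g} {u v : List Slice} {i : ℕ}
    (h : D.word = u ++ [cup i, cap i] ++ v) (h₀ : D₀.word = u ++ v) :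
    D.toSkein = loopValue • D₀.toSkein := by
  have := (KauffmanRelator.loop D D₀ u v i h h₀).mkQ_eq_zero
  rw [map_sub, map_smul, sub_eq_zero] at this
  exact this

theorem Diagram.toSkein_crossing {g : ℕ} {D D₁ D₂ : Diagram g} {u v : List Slice} {i : ℕ}
    (h : D.word = u ++ [cross true i] ++ v) (h₁ : D₁.word = u ++ v)
    (h₂ : D₂.word = u ++ [cap i, cup i] ++ v) :
    D.toSkein = (LaurentPolynomial.T 1 : ℤ[T;T⁻¹]) • D₁.toSkein
      + (LaurentPolynomial.T (-1) : ℤ[T;T⁻¹]) • D₂.toSkein := by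
  have := (KauffmanRelator.crossing D D₁ D₂ u v i h h₁ h₂).mkQ_eq_zero
  rw [map_sub, map_add, map_smul, map_smul, sub_eq_zero] at this
  exact this

theorem Diagram.toSkein_crossing' {g : ℕ} {D D₁ D₂ : Diagram g} {u v : List Slice} {i : ℕ}
    (h : D.word = u ++ [cross false i] ++ v) (h₁ : D₁.word = u ++ [cap i, cup i] ++ v)
    (h₂ : D₂.word = u ++ v) :
    D.toSkein = (LaurentPolynomial.T 1 : ℤ[T;T⁻¹]) • D₁.toSkein
      + (LaurentPolynomial.T (-1) : ℤ[T;T⁻¹]) • D₂.toSkein := by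
  have := (KauffmanRelator.crossing' D D₁ D₂ u v i h h₁ h₂).mkQ_eq_zero
  rw [map_sub, map_add, map_smul, map_smul, sub_eq_zero] at this
  exact this

theorem Reduces.planarClass_eq {g k : ℕ} {a b : List Slice} (h : Reduces k a b) (hk : k = 0)
    {D D' : Diagram g} {u v : List Slice} (hD : D.word = u ++ a ++ v)
    (hD' : D'.word = u ++ b ++ v) : D.planarClass = D'.planarClass := by
  induction h generalizing D D' u v with
  | refl w => rw [Diagram.ext_word (hD.trans hD'.symm)]
  | @trans k l a b c h₁ h₂ ih₁ ih₂ =>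
    have hf : Fits 0 (u ++ b ++ v) g := (h₁.append u v).fits (hD ▸ D.fits)
    exact (ih₁ (by lia) hD (D' := ⟨_, hf⟩) rfl).trans (ih₂ (by lia) rfl hD')
  | append u' v' _ ih =>
    exact ih hk (u := u ++ u') (v := v' ++ v) (by simpa using hD) (by simpa using hD')
  | exchange a b i k => exact LocalStep.planarClass_eq ⟨u, _, _, v, .exchange a b i k, hD, hD'⟩
  | exchange_symm a b i k =>
    exact (LocalStep.planarClass_eq ⟨u, _, _, v, .exchange a b i k, hD', hD⟩).symm
  | zigzag i => exact LocalStep.planarClass_eq ⟨u, _, _, v, .zigzag i, hD, hD'⟩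
  | zigzag' i => exact LocalStep.planarClass_eq ⟨u, _, _, v, .zigzag' i, hD, hD'⟩
  | loop i => simp at hk

theorem Reduces.toSkein_eq {g k : ℕ} {a b : List Slice} (h : Reduces k a b)
    {D D' : Diagram g} {u v : List Slice} (hD : D.word = u ++ a ++ v)
    (hD' : D'.word = u ++ b ++ v) : D.toSkein = loopValue ^ k • D'.toSkein := by
  induction h generalizing D D' u v with
  | @trans k l a b c h₁ h₂ ih₁ ih₂ =>
    have hf : Fits 0 (u ++ b ++ v) g := (h₁.append u v).fits (hD ▸ D.fits)
    rw [ih₁ hD (D' := ⟨_, hf⟩) rfl, ih₂ rfl hD', smul_smul, pow_add]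
  | append u' v' _ ih =>
    exact ih (u := u ++ u') (v := v' ++ v) (by simpa using hD) (by simpa using hD')
  | loop i =>
    rw [pow_one]
    exact Diagram.toSkein_loop hD (by simpa using hD')
  | _ =>
    rw [pow_zero, one_smul]
    refine Diagram.toSkein_eq_of_planarClass_eq (Reduces.planarClass_eq ?_ rfl hD hD')
    constructor

/-! ## Normal forms -/

/-- The word that consists of minima at the positions in `js`, read from right to left. -/
def cups : List ℕ → List Slice
  | [] => []
  | j :: js => cups js ++ [cup j]

/-- The normal form of `cups js ++ [cup i]`. -/
def insertCup (i : ℕ) : List ℕ → List ℕ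
  | [] => [i]
  | j :: js => if j < i then i :: j :: js else (j + 2) :: insertCup i js

/-- A new minimum at `i ≤ j` slides below the one at `j`, which it pushes to `j + 2`, and then
continues downwards. -/
theorem reduces_insertCup (i : ℕ) (js : List ℕ) :
    Reduces 0 (cups js ++ [cup i]) (cups (insertCup i js)) := by
  induction js with
  | nil => exact .refl _
  | cons j js ih =>
    by_cases h : j < i
    · simpa [insertCup, h, cups] using Reduces.refl _
    · obtain ⟨k, rfl⟩ := Nat.exists_eq_add_of_le (not_lt.1 h)
      have h₁ : Reduces 0 [cup (i + k), cup i] [cup i, cup (i + k + 2)] := by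
        simpa [cup, Piece.inp, Piece.out, add_right_comm] using
          Reduces.exchange_symm .cup .cup i k
      simpa [insertCup, cups] using (h₁.append_left (cups js)).trans
        (by simpa using ih.append_right [cup (i + k + 2)])

theorem insertCup_lt {i b : ℕ} {js : List ℕ} (h : ∀ x ∈ js, x < b) (hi : i < b + 2) :
    ∀ x ∈ insertCup i js, x < b + 2 := by
  induction js with
  | nil => simpa [insertCup] using hi
  | cons j js ih =>
    have hj := h j (by simp)
    have := ih fun x hx => h x (by simp [hx])
    grind [insertCup]

theorem pairwise_insertCup (i : ℕ) {js : List ℕ} (h : js.Pairwise (· > ·)) :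
    (insertCup i js).Pairwise (· > ·) := by
  induction js with
  | nil => simp [insertCup]
  | cons j js ih =>
    rw [List.pairwise_cons] at h
    unfold insertCup
    split_ifs with hj
    · simp only [List.pairwise_cons]
      grind
    · exact List.pairwise_cons.2 ⟨insertCup_lt h.1 (by lia), ih h.2⟩

/-- A maximum meeting the topmost minimum cancels it in a zigzag, closes a circle with it, or slides
below it. In the last case the induction absorbs the maximum, and the minimum is put back by
`insertCup`. -/
theorem exists_reduces_cap (i : ℕ) {js : List ℕ} {n : ℕ} (hf : Fits 0 (cups js ++ [cap i]) n)
    (h : js.Pairwise (· > ·)) : ∃ (k : ℕ) (ls : List ℕ), ls.Pairwise (· > ·) ∧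
      Reduces k (cups js ++ [cap i]) (cups ls) := by
  induction js generalizing i n with
  | nil => simp [cups, Fits, cap, Piece.inp] at hf
  | cons j js ih =>
    rw [List.pairwise_cons] at h
    have key : ∀ i' j' : ℕ, Reduces 0 [cup j, cap i] [cap i', cup j'] → ∃ (k : ℕ) (ls : List ℕ),
        ls.Pairwise (· > ·) ∧ Reduces k (cups (j :: js) ++ [cap i]) (cups ls) := by
      intro i' j' hr
      have hr' := hr.append_left (cups js)
      have hf' := hr'.fits (by simpa [cups] using hf)
      rw [show cups js ++ [cap i', cup j'] = (cups js ++ [cap i']) ++ [cup j'] by simp] at hf' hr'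
      obtain ⟨m, hm, -⟩ := fits_append.1 hf'
      obtain ⟨k, ls, hls, hk⟩ := ih i' hm h.2
      exact ⟨_, _, pairwise_insertCup j' hls, by
        simpa [cups] using (hr'.trans (hk.append_right [cup j'])).trans (reduces_insertCup j' ls)⟩
    have key' : ∀ k, Reduces k [cup j, cap i] [] → ∃ (k : ℕ) (ls : List ℕ),
        ls.Pairwise (· > ·) ∧ Reduces k (cups (j :: js) ++ [cap i]) (cups ls) :=
      fun k hr => ⟨k, js, h.2, by simpa [cups] using hr.append_left (cups js)⟩
    rcases lt_trichotomy i j with hij | rfl | hij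
    · obtain rfl | ⟨k, rfl⟩ : j = i + 1 ∨ ∃ k, j = i + 2 + k := by
        rcases (Nat.succ_le_of_lt hij).eq_or_lt with h | h
        · exact .inl h.symm
        · exact .inr (Nat.exists_eq_add_of_le h)
      · exact key' 0 (.zigzag' i)
      · exact key i (i + k) (.exchange_symm .cap .cup i k)
    · exact key' 1 (.loop i)
    · obtain rfl | ⟨k, rfl⟩ : i = j + 1 ∨ ∃ k, i = j + 2 + k := by
        rcases (Nat.succ_le_of_lt hij).eq_or_lt with h | h
        · exact .inl h.symm
        · exact .inr (Nat.exists_eq_add_of_le h)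
      · exact key' 0 (.zigzag j)
      · exact key (j + k) j (.exchange .cup .cap j k)

theorem exists_reduces_cups {w : List Slice} (hw : ∀ s ∈ w, ∀ c, s.piece ≠ .crossing c) {n : ℕ}
    (hf : Fits 0 w n) : ∃ (k : ℕ) (js : List ℕ), js.Pairwise (· > ·) ∧ Reduces k w (cups js) := by
  induction w using List.reverseRecOn generalizing n with
  | nil => exact ⟨0, [], .nil, .refl _⟩
  | append_singleton w s ih =>
    obtain ⟨m, hm, hs⟩ := fits_append.1 hf
    obtain ⟨k, js, hjs, hk⟩ := ih (fun s hs => hw s (by simp [hs])) hm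
    rcases s with ⟨_ | _ | c, i⟩
    · exact ⟨_, _, pairwise_insertCup i hjs, (hk.append_right _).trans (reduces_insertCup i js)⟩
    · obtain ⟨l, ls, hls, hl⟩ := exists_reduces_cap i ((hk.append_right _).fits hf) hjs
      exact ⟨_, _, hls, (hk.append_right _).trans hl⟩
    · exact absurd rfl (hw ⟨.crossing c, i⟩ (by simp) c)

theorem fits_unique {n m m' : ℕ} {w : List Slice} (h : Fits n w m) (h' : Fits n w m') :
    m = m' := by
  induction w generalizing n with
  | nil => exact h.symm.trans h'
  | cons s w ih => exact ih h.2 h'.2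

theorem mem_cups {js : List ℕ} {s : Slice} : s ∈ cups js ↔ ∃ j ∈ js, s = cup j := by
  induction js with
  | nil => simp [cups]
  | cons j js ih => simp [cups, ih, or_comm]

theorem fits_cups {js : List ℕ} {n : ℕ} (h : Fits 0 (cups js) n) :
    n = 2 * js.length ∧ ∀ j ∈ js, j < n := by
  induction js generalizing n with
  | nil => exact ⟨h.symm, by simp⟩
  | cons j js ih =>
    obtain ⟨m, hm, hj, rfl⟩ := fits_append.1 h
    obtain ⟨h₁, h₂⟩ := ih hm
    simp only [cup, Piece.inp, Piece.out] at hj ⊢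
    refine ⟨by simp [h₁]; ring, ?_⟩
    simp only [List.mem_cons, forall_eq_or_imp]
    exact ⟨by lia, fun x hx => by have := h₂ x hx; lia⟩

theorem crossingless_cups {g : ℕ} {D : Diagram g} {js : List ℕ} (h : D.word = cups js) :
    D.Crossingless := by
  intro s hs c
  rw [h, mem_cups] at hs
  obtain ⟨j, -, rfl⟩ := hs
  simp [cup]

/-- Without maxima every strand can be followed upwards to the top; the induction is on the number
of slices above the point. -/
theorem loopless_cups {g : ℕ} {D : Diagram g} {js : List ℕ} (h : D.word = cups js) :
    D.Loopless := by
  have key : ∀ d t n p, t + d = D.word.length → Fits n (D.word.drop t) g → p < n →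
      ∃ q < g, Relation.EqvGen (Adjacent D.word) (t, p) (D.word.length, q) := by
    intro d
    induction d with
    | zero =>
      intro t n p ht hf hp
      rw [List.drop_eq_nil_of_le (by lia)] at hf
      obtain rfl : n = g := hf
      obtain rfl : t = D.word.length := by lia
      exact ⟨p, hp, .refl _⟩
    | succ d ih =>
      intro t n p ht hf hp
      have hlt : t < D.word.length := by lia
      have hs : D.word[t]? = some D.word[t] := List.getElem?_eq_getElem hlt
      rw [List.drop_eq_getElem_cons hlt] at hf
      have hmem : D.word[t] ∈ cups js := by
        rw [← h]
        exact List.getElem_mem hlt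
      obtain ⟨j, -, hj⟩ := mem_cups.1 hmem
      rw [hj] at hs hf
      simp only [Fits, cup, Piece.inp, Piece.out] at hf
      by_cases hpj : p < j
      · obtain ⟨q, hq, hpq⟩ := ih (t + 1) _ p (by lia) hf.2 (by lia)
        exact ⟨q, hq, .trans _ _ _ (.rel _ _ (.left t _ p hs hpj)) hpq⟩
      · obtain ⟨q, hq, hpq⟩ := ih (t + 1) _ (p + 2) (by lia) hf.2 (by lia)
        exact ⟨q, hq, .trans _ _ _ (.rel _ _ (.right t _ p hs (not_lt.1 hpj))) hpq⟩
  intro t n p ht hf hp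
  obtain ⟨m, hm, hm'⟩ := fits_append.1
    (show Fits 0 (D.word.take t ++ D.word.drop t) g by rw [List.take_append_drop]; exact D.fits)
  obtain rfl := fits_unique hf hm
  exact key (D.word.length - t) t n p (by lia) hm' hp

/-! ## Labellings of crossingless diagrams -/

/-- The labels `x` above a slice extend the labels `y` below it: the labels at the two ends of a
minimum or of a maximum are opposite, and labels are constant along vertical strands. -/
def SliceLabelling : Slice → (ℕ → Bool) → (ℕ → Bool) → Prop
  | ⟨.cup, i⟩, y, x => y = removePair i x ∧ x (i + 1) = !x i
  | ⟨.cap, i⟩, y, x => x = removePair i y ∧ y (i + 1) = !y i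
  | ⟨.crossing _, _⟩, _, _ => False

/-- A labelling of all points of a crossingless diagram. -/
def IsLabelling (w : List Slice) (c : ℕ → ℕ → Bool) : Prop :=
  ∀ t s, w[t]? = some s → SliceLabelling s (c t) (c (t + 1))

theorem IsLabelling.snoc {w : List Slice} {c : ℕ → ℕ → Bool} (hc : IsLabelling w c) {s : Slice}
    {x : ℕ → Bool} (hs : SliceLabelling s (c w.length) x) :
    IsLabelling (w ++ [s]) (Function.update c (w.length + 1) x) := by
  intro t s' ht
  rcases lt_trichotomy t w.length with h | rfl | h
  · rw [List.getElem?_append_left h] at ht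
    rw [Function.update_of_ne (by lia), Function.update_of_ne (by lia)]
    exact hc t s' ht
  · simp only [List.getElem?_concat_length, Option.some.injEq] at ht
    subst ht
    simpa using hs
  · rw [List.getElem?_eq_none (by simp; lia)] at ht
    simp at ht

/-- Passing along a strand either keeps both labels or flips both, so agreement propagates. -/
theorem IsLabelling.agree_iff {w : List Slice} {c c' : ℕ → ℕ → Bool} (hc : IsLabelling w c)
    (hc' : IsLabelling w c') {x y : ℕ × ℕ} (h : Relation.EqvGen (Adjacent w) x y) :
    c x.1 x.2 = c' x.1 x.2 ↔ c y.1 y.2 = c' y.1 y.2 := by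
  induction h with
  | refl x => rfl
  | symm x y _ ih => exact ih.symm
  | trans x y z _ _ ih₁ ih₂ => exact ih₁.trans ih₂
  | rel x y h =>
    cases h with
    | left t s p hs hp =>
      have h₁ := hc t s hs
      have h₂ := hc' t s hs
      rcases s with ⟨_ | _ | _, i⟩
      · simp [h₁.1, h₂.1, removePair_of_lt _ hp]
      · simp [h₁.1, h₂.1, removePair_of_lt _ hp]
      · exact h₁.elim
    | right t s p hs hp =>
      have h₁ := hc t s hs
      have h₂ := hc' t s hs
      rcases s with ⟨_ | _ | _, i⟩
      · simp [h₁.1, h₂.1, removePair_of_le _ hp, Piece.inp, Piece.out]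
      · simp [h₁.1, h₂.1, removePair_of_le _ hp, Piece.inp, Piece.out]
      · exact h₁.elim
    | cup t i hs =>
      have h₁ := (hc t _ hs).2
      have h₂ := (hc' t _ hs).2
      simp [h₁, h₂]
    | cap t i hs =>
      have h₁ := (hc t _ hs).2
      have h₂ := (hc' t _ hs).2
      simp [h₁, h₂]
    | upRight t i b hs => exact (hc t _ hs).elim
    | upLeft t i b hs => exact (hc t _ hs).elim

/-- The number of labellings of a crossingless diagram with given labels at the top. -/
def labellingCount (w : List Slice) : (ℕ → Bool) → ℤ := wordOp (1 : ℤˣ) 1 w 1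

theorem labellingCount_nil (x : ℕ → Bool) : labellingCount [] x = 1 := rfl

theorem labellingCount_snoc_cup (w : List Slice) (i : ℕ) (x : ℕ → Bool) :
    labellingCount (w ++ [⟨.cup, i⟩]) x =
      if x (i + 1) = !x i then labellingCount w (removePair i x) else 0 := by
  simp [labellingCount, wordOp_append, wordOp, pieceOp, cupOp_apply, cupWeight]

theorem labellingCount_snoc_cap (w : List Slice) (i : ℕ) (x : ℕ → Bool) :
    labellingCount (w ++ [⟨.cap, i⟩]) x =
      labellingCount w (insertPair i true x) + labellingCount w (insertPair i false x) := by
  simp [labellingCount, wordOp_append, wordOp, pieceOp, capOp_apply, capWeight]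

/-- Only these consequences of counting are needed. The bound `p < m` makes the two labellings
differ at a point of the diagram, not at an idle index beyond its strands. -/
theorem labellingCount_spec {w : List Slice} (hw : ∀ s ∈ w, ∀ c, s.piece ≠ .crossing c) {n : ℕ}
    (hf : Fits 0 w n) (x : ℕ → Bool) :
    0 ≤ labellingCount w x ∧
    (0 < labellingCount w x → ∃ c, IsLabelling w c ∧ c w.length = x) ∧
    (1 < labellingCount w x → ∃ c c', IsLabelling w c ∧ IsLabelling w c' ∧ c w.length = x ∧
      c' w.length = x ∧ ∃ t ≤ w.length, ∃ m p, Fits 0 (w.take t) m ∧ p < m ∧ c t p ≠ c' t p) := by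
  induction w using List.reverseRecOn generalizing n x with
  | nil => simpa [labellingCount_nil, IsLabelling] using ⟨fun _ => x, rfl⟩
  | append_singleton w s ih =>
    obtain ⟨m, hm, hs⟩ := fits_append.1 hf
    replace ih := ih (fun s hs => hw s (by simp [hs])) hm
    have extend : ∀ y, SliceLabelling s y x → 0 < labellingCount w y →
        ∃ c, IsLabelling (w ++ [s]) c ∧ c (w ++ [s]).length = x ∧ c w.length = y := by
      intro y hy hpos
      obtain ⟨c, hc, rfl⟩ := (ih y).2.1 hpos
      exact ⟨_, hc.snoc hy, by simp, by simp⟩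
    have extend₂ : ∀ y, SliceLabelling s y x → 1 < labellingCount w y →
        ∃ c c', IsLabelling (w ++ [s]) c ∧ IsLabelling (w ++ [s]) c' ∧
          c (w ++ [s]).length = x ∧ c' (w ++ [s]).length = x ∧ ∃ t ≤ (w ++ [s]).length,
          ∃ m p, Fits 0 ((w ++ [s]).take t) m ∧ p < m ∧ c t p ≠ c' t p := by
      intro y hy hpos
      obtain ⟨c, c', hc, hc', rfl, h, t, ht, m, p, hm, hp, hne⟩ := (ih y).2.2 hpos
      refine ⟨_, _, hc.snoc hy, hc'.snoc (h ▸ hy), by simp, by simp, t, by simp; lia, m, p, ?_, hp,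
        ?_⟩
      · rwa [List.take_append_of_le_length ht]
      · rwa [Function.update_of_ne (by lia), Function.update_of_ne (by lia)]
    rcases s with ⟨_ | _ | c, i⟩
    · rw [labellingCount_snoc_cup]
      split_ifs with hx
      · refine ⟨(ih _).1, fun h => ?_, extend₂ _ ⟨rfl, hx⟩⟩
        obtain ⟨c, hc, h, -⟩ := extend _ ⟨rfl, hx⟩ h
        exact ⟨c, hc, h⟩
      · simp
    · rw [labellingCount_snoc_cap]
      have hi : ∀ b, SliceLabelling ⟨.cap, i⟩ (insertPair i b x) x := fun b =>
        ⟨(removePair_insertPair i b x).symm, by rw [insertPair_left, insertPair_right]⟩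
      have h₁ := (ih (insertPair i true x)).1
      have h₂ := (ih (insertPair i false x)).1
      refine ⟨by lia, fun h => ?_, fun h => ?_⟩
      · obtain h | h : 0 < labellingCount w (insertPair i true x) ∨
            0 < labellingCount w (insertPair i false x) := by lia
        all_goals
          obtain ⟨c, hc, h, -⟩ := extend _ (hi _) h
          exact ⟨c, hc, h⟩
      · obtain h | h | ⟨h, h'⟩ : 1 < labellingCount w (insertPair i true x) ∨
            1 < labellingCount w (insertPair i false x) ∨
            0 < labellingCount w (insertPair i true x) ∧
            0 < labellingCount w (insertPair i false x) := by lia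
        · exact extend₂ _ (hi _) h
        · exact extend₂ _ (hi _) h
        -- The two labellings differ at the left end of the new maximum, just below it.
        · obtain ⟨c, hc, htop, hc₁⟩ := extend _ (hi _) h
          obtain ⟨c', hc', htop', hc₁'⟩ := extend _ (hi _) h'
          refine ⟨c, c', hc, hc', htop, htop', w.length, by simp, m, i, by simpa using hm, ?_, ?_⟩
          · have := hs.1
            simp only [Piece.inp] at this
            lia
          · rw [hc₁, hc₁', insertPair_left, insertPair_left]
            simp
    · exact absurd rfl (hw ⟨.crossing c, i⟩ (by simp) c)

theorem Diagram.Loopless.labellingCount_le_one {g : ℕ} {D : Diagram g} (hD : D.Loopless)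
    (hD' : D.Crossingless) (x : ℕ → Bool) : labellingCount D.word x ≤ 1 := by
  by_contra! h
  obtain ⟨c, c', hc, hc', hx, hx', t, ht, m, p, hm, hp, hne⟩ :=
    (labellingCount_spec hD' D.fits x).2.2 h
  obtain ⟨q, -, hq⟩ := hD t m p ht hm hp
  refine hne ((hc.agree_iff hc' hq).2 ?_)
  simp [hx, hx']

/-! ## Triangularity -/

/-- The labelling that is `true` at the positions in `js`. -/
def mark (js : List ℕ) : ℕ → Bool := fun p => decide (p ∈ js)

theorem removePair_mark {j : ℕ} {js : List ℕ} (h : ∀ x ∈ js, j > x) :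
    removePair j (mark (j :: js)) = mark js := by
  ext p
  simp only [removePair, mark]
  grind

section Spin

variable {R : Type*} [CommRing R] (a t : Rˣ)

theorem wordOp_cups_cons (j : ℕ) (js : List ℕ) (x : ℕ → Bool) :
    wordOp a t (cups (j :: js)) 1 x = (if x (j + 1) = !x j then cupWeight a (x j) else 0) *
      wordOp a t (cups js) 1 (removePair j x) := by
  simp [cups, wordOp_append, wordOp, pieceOp, cup, cupOp_apply]

/-- As positions increase upwards, later minima do not move earlier left ends, so `js` lists the
left ends at the top. Each arc then reads `true`, `false` and has weight `a`. -/
theorem wordOp_cups_mark {js : List ℕ} (h : js.Pairwise (· > ·)) :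
    wordOp a t (cups js) 1 (mark js) = (a : R) ^ js.length := by
  induction js with
  | nil => simp [cups, wordOp]
  | cons j js ih =>
    rw [List.pairwise_cons] at h
    have h₁ : mark (j :: js) j = true := by simp [mark]
    have h₂ : mark (j :: js) (j + 1) = false := by
      have : j + 1 ∉ js := fun hj => by have := h.1 _ hj; lia
      simp [mark, this]
    rw [wordOp_cups_cons, removePair_mark h.1, ih h.2, h₁, h₂]
    simp [cupWeight, pow_succ']

/-- A labelling in the support of a word of minima equals the leading labelling or is smaller in
the lexicographic order. -/
theorem eq_or_lt_of_wordOp_cups_ne_zero {js : List ℕ} {n : ℕ} (hf : Fits 0 (cups js) n)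
    (h : js.Pairwise (· > ·)) {x : ℕ → Bool}
    (hx : wordOp a t (cups js) 1 x ≠ 0) :
    (∀ p < 2 * js.length, x p = mark js p) ∨
      ∃ p, (∀ q < p, x q = mark js q) ∧ mark js p = true ∧ x p = false := by
  induction js generalizing x n with
  | nil => simp
  | cons j js ih =>
    rw [List.pairwise_cons] at h
    rw [wordOp_cups_cons] at hx
    have hne := right_ne_zero_of_mul hx
    have hj : x (j + 1) = !x j := by
      by_contra hj
      simp [hj] at hx
    have hr := removePair_mark h.1
    have hlt : ∀ q < j, mark (j :: js) q = mark js q := fun q hq => by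
      rw [← hr, removePair_of_lt _ hq]
    have h₁ : mark (j :: js) j = true := by simp [mark]
    obtain ⟨m, hm, hjm, -⟩ := fits_append.1 hf
    have hm₁ := (fits_cups hm).1
    simp only [cup, Piece.inp] at hjm
    rcases ih hm h.2 hne with heq | ⟨p, hp, hp₁, hp₂⟩
    · have hxq : ∀ q < j, x q = mark (j :: js) q := fun q hq => by
        rw [hlt q hq, ← heq q (by lia), removePair_of_lt _ hq]
      -- If the topmost arc has the label `false` at its left end, `j` is the first place where `x`
      -- falls below the marking.
      cases hxj : x j with
      | false => exact .inr ⟨j, hxq, h₁, hxj⟩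
      | true =>
        refine .inl fun p hp => ?_
        rw [List.length_cons] at hp
        rcases lt_or_ge p j with hpj | hpj
        · exact hxq p hpj
        obtain ⟨p, rfl⟩ := Nat.exists_eq_add_of_le hpj
        match p with
        | 0 => rw [add_zero, hxj, h₁]
        | 1 =>
          have : j + 1 ∉ js := fun hj => by have := h.1 _ hj; lia
          simp [hj, hxj, mark, this]
        | p + 2 =>
          have hle : j ≤ j + p := Nat.le_add_right _ _
          rw [← add_assoc, ← removePair_of_le x hle, heq (j + p) (by lia),
            ← removePair_of_le (mark (j :: js)) hle, hr]
    · have hpj : p < j := h.1 p (by simpa [mark] using hp₁)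
      refine .inr ⟨p, fun q hq => ?_, ?_, ?_⟩
      · rw [hlt q (hq.trans hpj), ← hp q hq, removePair_of_lt _ (hq.trans hpj)]
      · rw [hlt p hpj, hp₁]
      · rw [← hp₂, removePair_of_lt _ hpj]

end Spin

/-! ## The bracket -/

/-- The variable `A` as a unit. -/
noncomputable def unitA : ℤ[T;T⁻¹]ˣ where
  val := LaurentPolynomial.T 1
  inv := LaurentPolynomial.T (-1)
  val_inv := by rw [← LaurentPolynomial.T_add]; simp
  inv_val := by rw [← LaurentPolynomial.T_add]; simp

/-- The action of a word for the parameters of the Kauffman bracket. -/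
noncomputable def bracketOp (w : List Slice) : Module.End ℤ[T;T⁻¹] ((ℕ → Bool) → ℤ[T;T⁻¹]) :=
  wordOp (-unitA ^ 2) unitA w

theorem loopValue_eq : ((-unitA ^ 2 : ℤ[T;T⁻¹]ˣ) : ℤ[T;T⁻¹]) + ((-unitA ^ 2)⁻¹ : ℤ[T;T⁻¹]ˣ)
    = loopValue := by
  rw [show (-unitA ^ 2)⁻¹ = -(unitA⁻¹) ^ 2 by simp, loopValue, sub_eq_add_neg]
  simp only [Units.val_neg, Units.val_pow_eq_pow_val]
  simp [unitA, LaurentPolynomial.T_pow]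

/-- The bracket of a framed tangle. -/
noncomputable def FramedTangle.bracket {g : ℕ} :
    FramedTangle g → (ℕ → Bool) → ℤ[T;T⁻¹] :=
  Quot.lift (fun D => bracketOp D.word 1) fun D D' h => by
    rcases h with ⟨u, a, b, v, h, hD, hD'⟩ | ⟨u, a, b, v, h, hD, hD'⟩
    · simp only [hD, hD', bracketOp, wordOp_append, wordOp_planarMove _ _ h]
    · have hab : wordOp (-unitA ^ 2) unitA a = wordOp (-unitA ^ 2) unitA b :=
        wordOp_reidemeisterMove (by simp) h
      simp only [hD, hD', bracketOp, wordOp_append, hab]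

theorem KauffmanRelator.linearCombination_bracket_eq_zero {g : ℕ} {x : TangleModule g}
    (h : KauffmanRelator g x) :
    Finsupp.linearCombination ℤ[T;T⁻¹] FramedTangle.bracket x = 0 := by
  have hgen : ∀ D : Diagram g, Finsupp.linearCombination ℤ[T;T⁻¹] FramedTangle.bracket D.gen
      = bracketOp D.word 1 := fun D => by
    rw [Diagram.gen, Finsupp.linearCombination_single, one_smul]
    rfl
  cases h with
  | loop D D₀ u v i h h₀ =>
    have hl : bracketOp [cup i, cap i] = loopValue • 1 := by
      rw [bracketOp, (Reduces.loop i).wordOp_eq, loopValue_eq, pow_one, wordOp]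
    rw [map_sub, map_smul, hgen, hgen, sub_eq_zero, h, h₀]
    simp only [bracketOp, wordOp_append] at hl ⊢
    rw [hl]
    simp [loopValue]
  | crossing D D₁ D₂ u v i h h₁ h₂ =>
    rw [map_sub, map_add, map_smul, map_smul, hgen, hgen, hgen, sub_eq_zero, h, h₁, h₂]
    simp [bracketOp, wordOp_append, wordOp, pieceOp, cross, cup, cap, unitA]
  | crossing' D D₁ D₂ u v i h h₁ h₂ =>
    rw [map_sub, map_add, map_smul, map_smul, hgen, hgen, hgen, sub_eq_zero, h, h₁, h₂]
    simp [bracketOp, wordOp_append, wordOp, pieceOp, cross, cup, cap, unitA]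

/-- The bracket as a linear map on the skein module. -/
noncomputable def skeinBracket (g : ℕ) :
    SkeinModule g →ₗ[ℤ[T;T⁻¹]] ((ℕ → Bool) → ℤ[T;T⁻¹]) :=
  (kauffmanSubmodule g).liftQ (Finsupp.linearCombination ℤ[T;T⁻¹] FramedTangle.bracket)
    (Submodule.span_le.2 fun _ h => h.linearCombination_bracket_eq_zero)

theorem skeinBracket_toSkein {g : ℕ} (D : Diagram g) :
    skeinBracket g D.toSkein = bracketOp D.word 1 := by
  have h : skeinBracket g D.toSkein =
      Finsupp.linearCombination ℤ[T;T⁻¹] FramedTangle.bracket (Finsupp.single D.tangle 1) := rfl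
  rw [h, Finsupp.linearCombination_single, one_smul]
  rfl

/-! ## Base tangles -/

/-- The base tangle drawn by the minima at the positions in `js`. -/
def cupsBase {g : ℕ} (js : List ℕ) (h : Fits 0 (cups js) g) : BaseTangle g :=
  ⟨Diagram.planarClass ⟨cups js, h⟩, ⟨cups js, h⟩, crossingless_cups rfl, loopless_cups rfl, rfl⟩

/-- Counting labellings excludes circles, so invariance of `Loopless` under planar moves is never
needed. -/
theorem exists_eq_cupsBase {g : ℕ} (B : BaseTangle g) :
    ∃ (js : List ℕ) (h : Fits 0 (cups js) g), js.Pairwise (· > ·) ∧ B = cupsBase js h := by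
  obtain ⟨B, D, hD, hD', rfl⟩ := B
  obtain ⟨k, js, hjs, hk⟩ := exists_reduces_cups hD D.fits
  have hone := hD'.labellingCount_le_one hD (mark js)
  -- The count at `mark js` is `2 ^ k`, but looplessness bounds it by 1.
  have hk₀ : k = 0 := by
    rw [labellingCount, hk.wordOp_eq, LinearMap.smul_apply, Pi.smul_apply,
      wordOp_cups_mark _ _ hjs] at hone
    by_contra hk₀
    have := Nat.one_lt_two_pow hk₀
    norm_num at hone
    exact absurd hone (not_le.2 (by exact_mod_cast this))
  exact ⟨js, hk.fits D.fits, hjs, Subtype.ext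
    (hk.planarClass_eq hk₀ (u := []) (v := []) (by simp) (by simp))⟩

theorem linearIndependent_toSkein (g : ℕ) :
    LinearIndependent ℤ[T;T⁻¹] (BaseTangle.toSkein : BaseTangle g → SkeinModule g) := by
  choose js hf hjs hB using fun B : BaseTangle g => exists_eq_cupsBase B
  have hbr : ∀ B : BaseTangle g, skeinBracket g B.toSkein = bracketOp (cups (js B)) 1 := by
    intro B
    conv_lhs => rw [hB B]
    exact skeinBracket_toSkein ⟨cups (js B), hf B⟩
  rw [linearIndependent_iff]
  intro l hl
  by_contra hne
  -- Evaluated at the largest leading labelling, the relation retains only the term of `B₀`, whose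
  -- bracket value there is a unit.
  obtain ⟨B₀, hB₀, hmax⟩ := Finset.exists_max_image l.support
    (fun B => toLex fun p : Fin g => mark (js B) p) (Finsupp.support_nonempty_iff.2 hne)
  have hsum := congrFun (congrArg (skeinBracket g) hl) (mark (js B₀))
  rw [Finsupp.linearCombination_apply, Finsupp.sum, map_sum, Finset.sum_apply, map_zero,
    Finset.sum_eq_single_of_mem B₀ hB₀] at hsum
  · rw [map_smul, hbr, Pi.smul_apply, bracketOp, wordOp_cups_mark _ _ (hjs B₀), smul_eq_mul,
      Pi.zero_apply, ← Units.val_pow_eq_pow_val, Units.mul_left_eq_zero] at hsum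
    exact Finsupp.mem_support_iff.1 hB₀ hsum
  · intro B hBl hBB₀
    rw [map_smul, hbr, Pi.smul_apply, bracketOp]
    by_contra h0
    have h1 := right_ne_zero_of_smul h0
    have hlen := (fits_cups (hf B)).1
    rcases eq_or_lt_of_wordOp_cups_ne_zero _ _ (hf B) (hjs B) h1 with heq | ⟨p, hp, hp₁, hp₂⟩
    · refine hBB₀ ?_
      have hmem : ∀ p, p ∈ js B ↔ p ∈ js B₀ := fun p => by
        by_cases hp : p < g
        · simpa [mark] using (heq p (by lia)).symm
        · exact ⟨fun h => absurd ((fits_cups (hf B)).2 p h) hp,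
            fun h => absurd ((fits_cups (hf B₀)).2 p h) hp⟩
      -- A strictly decreasing list is determined by its set of entries.
      have hjs' : js B = js B₀ := by
        refine List.Perm.eq_of_pairwise (le := (· > ·)) ?_ (hjs B) (hjs B₀) ?_
        · intro a b _ _ h h'
          exact absurd h (lt_asymm h')
        · exact (List.perm_ext_iff_of_nodup ((hjs B).imp fun h => h.ne')
            ((hjs B₀).imp fun h => h.ne')).2 hmem
      rw [hB B, hB B₀]
      simp only [hjs']
    · have hpg : p < g := (fits_cups (hf B)).2 p (by simpa [mark] using hp₁)
      refine not_lt.2 (hmax B hBl) ⟨⟨p, hpg⟩, fun q hq => hp q hq, ?_⟩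
      simp [hp₁, hp₂]

/-! ## The grading modulo 4 -/

/-- The degree of a slice modulo 4. -/
def Slice.degree : Slice → ZMod 4
  | ⟨.cup, i⟩ => 2 * i
  | ⟨.cap, i⟩ => 2 * i + 2
  | ⟨.crossing true, _⟩ => 1
  | ⟨.crossing false, _⟩ => -1

/-- The degree of a word modulo 4: all exponents of the coefficient of a base tangle `B` in the
expansion of a diagram `D` are congruent to the difference of the degrees of `D` and `B`. -/
def wordDegree (w : List Slice) : ZMod 4 := (w.map Slice.degree).sum

theorem wordDegree_append (u v : List Slice) :
    wordDegree (u ++ v) = wordDegree u + wordDegree v := by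
  simp [wordDegree]

theorem Slice.degree_add_two (b : Piece) (p : ℕ) :
    Slice.degree ⟨b, p + 2⟩ = Slice.degree ⟨b, p⟩ := by
  have h4 : (4 : ZMod 4) = 0 := rfl
  rcases b with _ | _ | _ | _ <;> simp only [Slice.degree]
  all_goals
    push_cast
    linear_combination h4

/-- Shifting a piece by two strands changes its degree by a multiple of 4, a zigzag has degree `4 *
(i + 1)`, and flipping a crossing changes the degree by 2, as does moving a minimum or maximum by
one place. -/
theorem wordDegree_planarMove {u v : List Slice} (h : PlanarMove u v) :
    wordDegree u = wordDegree v := by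
  have h4 : (4 : ZMod 4) = 0 := rfl
  cases h with
  | exchange a b i k =>
    have h : Slice.degree ⟨b, i + a.out + k⟩ = Slice.degree ⟨b, i + a.inp + k⟩ := by
      cases a <;> simp only [Piece.inp, Piece.out, add_right_comm i 2 k, Slice.degree_add_two,
        add_zero]
    simp only [wordDegree, List.map_cons, List.map_nil, List.sum_cons, List.sum_nil, h]
    ring
  | zigzag i =>
    simp [wordDegree, Slice.degree, cup, cap]
    linear_combination (i + 1 : ZMod 4) * h4
  | zigzag' i =>
    simp [wordDegree, Slice.degree, cup, cap]
    linear_combination (i + 1 : ZMod 4) * h4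
  | swingCap c i =>
    cases c <;> simp [wordDegree, Slice.degree, cross, cap]
    · ring
    · linear_combination h4
  | swingCup c i =>
    cases c <;> simp [wordDegree, Slice.degree, cross, cup]
    · ring
    · linear_combination h4

/-- A circle has degree 2, matching the exponents `2` and `-2` of `loopValue`. -/
theorem Reduces.wordDegree_eq {k : ℕ} {u v : List Slice} (h : Reduces k u v) :
    wordDegree u = k * 2 + wordDegree v := by
  induction h with
  | refl w => simp
  | trans _ _ ih₁ ih₂ => rw [ih₁, ih₂]; push_cast; ring
  | append u v _ ih => simp only [wordDegree_append, ih]; ring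
  | exchange b c i k => simpa using wordDegree_planarMove (.exchange b c i k)
  | exchange_symm b c i k => simpa using (wordDegree_planarMove (.exchange b c i k)).symm
  | zigzag i => simpa using wordDegree_planarMove (.zigzag i)
  | zigzag' i => simpa using wordDegree_planarMove (.zigzag' i)
  | loop i =>
    have h4 : (4 : ZMod 4) = 0 := rfl
    simp [wordDegree, Slice.degree, cup, cap]
    linear_combination (i : ZMod 4) * h4

/-- The degree of a planar isotopy class modulo 4. -/
def PlanarClass.degree {g : ℕ} : PlanarClass g → ZMod 4 :=
  Quot.lift (fun D => wordDegree D.word) fun D D' ⟨u, a, b, v, h, hD, hD'⟩ => by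
    simp only [hD, hD', wordDegree_append, wordDegree_planarMove h]

/-! ### Homogeneous expansions -/

/-- The Laurent polynomials all of whose exponents are congruent to `c` modulo 4. -/
noncomputable abbrev homogeneous (c : ZMod 4) : Submodule ℤ ℤ[T;T⁻¹] :=
  AddMonoidAlgebra.gradeBy ℤ (Int.castAddHom (ZMod 4)) c

theorem mem_homogeneous {c : ZMod 4} {p : ℤ[T;T⁻¹]} :
    p ∈ homogeneous c ↔ ∀ n ∈ p.coeff.support, (n : ZMod 4) = c :=
  Iff.rfl

theorem T_mem_homogeneous {n : ℤ} {c : ZMod 4} (h : (n : ZMod 4) = c) :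
    LaurentPolynomial.T n ∈ homogeneous c := by
  rw [mem_homogeneous]
  simp [h]

theorem loopValue_mem_homogeneous : loopValue ∈ homogeneous 2 :=
  sub_mem (neg_mem (T_mem_homogeneous rfl)) (T_mem_homogeneous rfl)

theorem T_smul_apply_mem_homogeneous {ι : Type*} {P : ι →₀ ℤ[T;T⁻¹]} {B : ι} {n : ℤ}
    {c d : ZMod 4} (hP : P B ∈ homogeneous d) (h : (n : ZMod 4) + d = c) :
    ((LaurentPolynomial.T n : ℤ[T;T⁻¹]) • P) B ∈ homogeneous c := by
  rw [Finsupp.smul_apply, smul_eq_mul, ← h]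
  exact SetLike.mul_mem_graded (T_mem_homogeneous rfl) hP

/-- Induction on the number of crossings. The smoothing `[cap i, cup i]` has degree 2 and the
trivial one degree 0, so multiplication by `A` or `A⁻¹` restores the degree of the crossing, 1 or
-1. -/
theorem exists_homogeneous_expansion {g : ℕ} (D : Diagram g) :
    ∃ P : BaseTangle g →₀ ℤ[T;T⁻¹],
      D.toSkein = Finsupp.linearCombination ℤ[T;T⁻¹] BaseTangle.toSkein P ∧
      ∀ B, P B ∈ homogeneous (wordDegree D.word - B.1.degree) := by
  obtain ⟨n, hn⟩ : ∃ n, n = D.word.countP fun s => decide (∃ c, s.piece = .crossing c) := ⟨_, rfl⟩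
  induction n using Nat.strong_induction_on generalizing D with
  | _ n ih =>
  by_cases hD : D.Crossingless
  · classical
    obtain ⟨k, js, hjs, hk⟩ := exists_reduces_cups hD D.fits
    have hf := hk.fits D.fits
    refine ⟨Finsupp.single (cupsBase js hf) (loopValue ^ k), ?_, fun B => ?_⟩
    · rw [Finsupp.linearCombination_single]
      exact hk.toSkein_eq (D' := ⟨cups js, hf⟩) (u := []) (v := []) (by simp) (by simp)
    · rw [Finsupp.single_apply]
      split_ifs with h
      · have hdeg : B.1.degree = wordDegree (cups js) := by rw [← h]; rfl
        rw [hk.wordDegree_eq, hdeg, add_sub_cancel_right, ← nsmul_eq_mul]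
        exact SetLike.pow_mem_graded k loopValue_mem_homogeneous
      · exact zero_mem _
  · simp only [Diagram.Crossingless, not_forall, not_not] at hD
    obtain ⟨⟨p, i⟩, hs, c, rfl : p = .crossing c⟩ := hD
    obtain ⟨u, v, hw⟩ := List.append_of_mem hs
    have hw' : D.word = u ++ [cross c i] ++ v := by simp [hw, cross]
    have hfits := D.fits
    rw [hw'] at hfits
    have hf₁ : Fits 0 (u ++ v) g := by
      simp only [fits_append, Fits, cross, Piece.inp, Piece.out] at hfits ⊢
      obtain ⟨m, ⟨l, hl, hi, rfl⟩, hm⟩ := hfits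
      exact ⟨l, hl, by rwa [Nat.sub_add_cancel (by lia)] at hm⟩
    have hf₂ : Fits 0 (u ++ [cap i, cup i] ++ v) g := by
      simp only [fits_append, Fits, cross, cup, cap, Piece.inp, Piece.out] at hfits ⊢
      obtain ⟨m, ⟨l, hl, hi, rfl⟩, hm⟩ := hfits
      exact ⟨_, ⟨l, hl, hi, by lia, rfl⟩, hm⟩
    obtain ⟨P₁, hP₁, hd₁⟩ := ih _ (by simp [hn, hw, List.countP_append]) ⟨_, hf₁⟩ rfl
    obtain ⟨P₂, hP₂, hd₂⟩ := ih _ (by simp [hn, hw, cup, cap, List.countP_append]) ⟨_, hf₂⟩ rfl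
    have h4 : (4 : ZMod 4) = 0 := rfl
    cases c with
    | true =>
      refine ⟨(LaurentPolynomial.T 1 : ℤ[T;T⁻¹]) • P₁ +
        (LaurentPolynomial.T (-1) : ℤ[T;T⁻¹]) • P₂, ?_, fun B => ?_⟩
      · rw [map_add, map_smul, map_smul, ← hP₁, ← hP₂]
        exact Diagram.toSkein_crossing hw' rfl rfl
      · refine add_mem ?_ ?_
        · refine T_smul_apply_mem_homogeneous (hd₁ B) ?_
          simp only [hw', wordDegree_append]
          simp [wordDegree, Slice.degree, cross]
          ring
        · refine T_smul_apply_mem_homogeneous (hd₂ B) ?_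
          simp only [hw', wordDegree_append]
          simp [wordDegree, Slice.degree, cross, cup, cap]
          linear_combination (i : ZMod 4) * h4
    | false =>
      refine ⟨(LaurentPolynomial.T 1 : ℤ[T;T⁻¹]) • P₂ +
        (LaurentPolynomial.T (-1) : ℤ[T;T⁻¹]) • P₁, ?_, fun B => ?_⟩
      · rw [map_add, map_smul, map_smul, ← hP₁, ← hP₂]
        exact Diagram.toSkein_crossing' hw' rfl rfl
      · refine add_mem ?_ ?_
        · refine T_smul_apply_mem_homogeneous (hd₂ B) ?_
          simp only [hw', wordDegree_append]
          simp [wordDegree, Slice.degree, cross, cup, cap]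
          linear_combination (i + 1 : ZMod 4) * h4
        · refine T_smul_apply_mem_homogeneous (hd₁ B) ?_
          simp only [hw', wordDegree_append]
          simp [wordDegree, Slice.degree, cross]
          ring

theorem exists_laurentSpan_eq_of_mem_homogeneous {c : ZMod 4} {p : ℤ[T;T⁻¹]}
    (hp : p ∈ homogeneous c) : ∃ k : ℕ, laurentSpan p = 4 * (k : ℤ) := by
  unfold laurentSpan
  split_ifs with h
  · rw [mem_homogeneous] at hp
    have h₁ := hp _ (p.coeff.support.max'_mem h)
    have h₂ := hp _ (p.coeff.support.min'_mem h)
    obtain ⟨k, hk⟩ := (ZMod.intCast_eq_intCast_iff_dvd_sub _ _ 4).1 (h₂.trans h₁.symm)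
    have hle := p.coeff.support.min'_le _ (p.coeff.support.max'_mem h)
    refine ⟨k.toNat, ?_⟩
    rw [hk, Int.toNat_of_nonneg]
    · rfl
    · push_cast at hk
      lia
  · exact ⟨0, rfl⟩

end Skein

theorem mainTheorem7 (g : ℕ) (T : Skein.FramedTangle g) :
    ∃ P : Skein.BaseTangle g →₀ LaurentPolynomial ℤ,
      Skein.IsExpansion T P ∧
      (∀ P' : Skein.BaseTangle g →₀ LaurentPolynomial ℤ, Skein.IsExpansion T P' → P' = P) ∧
      ∀ B : Skein.BaseTangle g, ∃ k : ℕ, Skein.laurentSpan (P B) = 4 * (k : ℤ) := by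
  obtain ⟨D, rfl⟩ := Quot.exists_rep T
  obtain ⟨P, hP, hd⟩ := Skein.exists_homogeneous_expansion D
  -- One diagram suffices for the span: the coefficients are unique by linear independence, so the
  -- degree need not be shown invariant under Reidemeister moves.
  refine ⟨P, hP, fun P' hP' => ?_,
    fun B => Skein.exists_laurentSpan_eq_of_mem_homogeneous (hd B)⟩
  exact Skein.linearIndependent_toSkein g (hP'.symm.trans hP)
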